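/- Let $S=\{s_1,\dots,s_n\}$ be a set of $n\ge 1$ pairwise disjoint closed line segments in the plane. For $R\subseteq S$, the trapezoidal map of $R$ is the subdivision of the plane obtained by drawing the segments of $R$ and, from every endpoint of a segment of $R$, the vertical extensions upwards and downwards until they hit the next segment of $R$ (or to infinity if there is none). Its trapezoids are the connected components of the complement of this drawing. The randomized incremental construction (RIC) inserts the segments of $S$ one at a time, in an order $\pi$ chosen uniformly at random among all $n!$ orders, and maintains the trapezoidal map of the segments inserted so far. For a point $q\in\mathbb R^2$ let $Z_q(\pi)$ be the number of insertion steps in which the trapezoid containing $q$ changes (a point on the drawing lies in no trapezoid, and passing between lying in a trapezoid and lying in none counts as a change). Then for every $\alpha>0$ there is a constant $C>0$, depending only on $\alpha$, such that for all $n\ge 1$, all such $S$, and every query point $q\in\mathbb R^2$, $$\Pr_\pi\bigl[\,Z_q(\pi) > C\log n\,\bigr]\le n^{-\alpha}.$$ -/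

import Mathlib

/-- A line segment in the plane, given by its two distinct endpoints. -/
structure PlaneSegment where
  a : ℝ × ℝ
  b : ℝ × ℝ
  ne : a ≠ b

namespace PlaneSegment

/-- The closed set of points of the segment. -/
def carrier (s : PlaneSegment) : Set (ℝ × ℝ) := segment ℝ s.a s.b

/-- The two endpoints of the segment. -/
def endpoints (s : PlaneSegment) : Set (ℝ × ℝ) := {s.a, s.b}

end PlaneSegment

/-- The points covered by a set of segments. -/
def coveredBy (R : Set PlaneSegment) : Set (ℝ × ℝ) := ⋃ s ∈ R, s.carrier

/-- The vertical extension of a point `p`: all points `z` on the vertical line through `p` such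
that no segment of `R` meets the open vertical segment between `p` and `z`. Thus the extension runs
up and down from `p` until it hits the next segment of `R`, or to infinity if there is none. -/
def verticalExtension (R : Set PlaneSegment) (p : ℝ × ℝ) : Set (ℝ × ℝ) :=
  {z | z.1 = p.1 ∧ Disjoint (openSegment ℝ p z) (coveredBy R)}

/-- The segments of `R` together with the vertical extensions of all their endpoints. -/
def trapezoidalSkeleton (R : Set PlaneSegment) : Set (ℝ × ℝ) :=
  coveredBy R ∪ ⋃ s ∈ R, ⋃ p ∈ s.endpoints, verticalExtension R p

/-- The trapezoidal map (vertical decomposition) of `R`: the set of its trapezoids, which are the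
connected components of the complement of the skeleton (some of them unbounded). -/
def trapezoidalMap (R : Set PlaneSegment) : Set (Set (ℝ × ℝ)) :=
  {Δ | ∃ z ∈ (trapezoidalSkeleton R)ᶜ, Δ = connectedComponentIn (trapezoidalSkeleton R)ᶜ z}

/-- The trapezoid containing `q`, as the set of all trapezoids of the map that contain `q`: it has
exactly one element if `q` is not on the skeleton, and is empty if `q` is on the skeleton. -/
def trapezoidContaining (R : Set PlaneSegment) (q : ℝ × ℝ) : Set (Set (ℝ × ℝ)) :=
  {Δ ∈ trapezoidalMap R | q ∈ Δ}

/-- The segments inserted by the randomized incremental construction in its first `i` steps, when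
the insertion order is `S (π 0), S (π 1), …`. -/
def ricPrefix {n : ℕ} (S : Fin n → PlaneSegment) (π : Equiv.Perm (Fin n)) (i : ℕ) :
    Set PlaneSegment :=
  {s | ∃ j : Fin n, (j : ℕ) < i ∧ s = S (π j)}

/-- The number of insertion steps in which the trapezoid containing `q` in the maintained
trapezoidal map changes. -/
noncomputable def ricChanges {n : ℕ} (S : Fin n → PlaneSegment) (π : Equiv.Perm (Fin n))
    (q : ℝ × ℝ) : ℕ :=
  {i : Fin n | trapezoidContaining (ricPrefix S π (i : ℕ)) q ≠
    trapezoidContaining (ricPrefix S π ((i : ℕ) + 1)) q}.ncard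

/-! The proof is backwards analysis applied to an exponential moment. Suppose that in every set of
inserted segments at most four are critical, meaning that removing any other one leaves the
trapezoid of `q` unchanged. A uniform order has a uniform last element, and the order of the rest is
again uniform. Conditioning on the last element, 2 to the power of the number of changes gains the
factor 2 for at most four of the choices. Hence its sum over all orders grows by at most (n + 1) + 4
from n to n + 1, and its mean is at most (n + 4)! / (4! n!), a polynomial in n
(`sum_changeWeight_le`). Markov's inequality gives the tail bound (`card_changes_gt_le`), and no
independence of the steps is needed.

The geometric input is `exists_critical_segments`. The trapezoid of a point off the skeleton is a
convex open `cell`, cut out by at most one segment above, one below, and one endpoint on each side.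
`IsCellOf` lists properties of these data that force the cell to be the trapezoid
(`IsCellOf.connectedComponentIn_eq`) and that survive the removal of all other segments
(`IsCellOf.mono`). Vertical segments and endpoints with equal abscissae are allowed. A sign `σ`
treats mirror images together: for `T` it means above (1) or below (-1), for `P` right or left. -/

/-! ### Exponential moments of change counts along random permutations -/

/-- The set of the first `i` values of a permutation. -/
def permPrefix {n : ℕ} (π : Equiv.Perm (Fin n)) (i : ℕ) : Set (Fin n) :=
  {x | ∃ j : Fin n, (j : ℕ) < i ∧ x = π j}

open Classical in
/-- Two to the power of the number of steps in which `F` changes along the prefixes of `π`. -/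
noncomputable def changeWeight {n : ℕ} {β : Type*} (F : Set (Fin n) → β)
    (π : Equiv.Perm (Fin n)) : ℕ :=
  ∏ i : Fin n, if F (permPrefix π (i : ℕ)) ≠ F (permPrefix π ((i : ℕ) + 1)) then 2 else 1

theorem changeWeight_eq_two_pow {n : ℕ} {β : Type*} (F : Set (Fin n) → β)
    (π : Equiv.Perm (Fin n)) :
    changeWeight F π =
      2 ^ {i : Fin n | F (permPrefix π (i : ℕ)) ≠ F (permPrefix π ((i : ℕ) + 1))}.ncard := by
  classical
  rw [changeWeight, Finset.prod_ite, Finset.prod_const, Finset.prod_const_one, mul_one,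
    ← Set.ncard_coe_finset]
  simp

/-- The permutation of `Fin (n + 1)` with last value `j` whose other values are ordered as by
`σ`. -/
def permSnoc {n : ℕ} (j : Fin (n + 1)) (σ : Equiv.Perm (Fin n)) : Equiv.Perm (Fin (n + 1)) :=
  (finSuccEquivLast.trans (Equiv.optionCongr σ)).trans (finSuccEquiv' j).symm

theorem permSnoc_last {n : ℕ} (j : Fin (n + 1)) (σ : Equiv.Perm (Fin n)) :
    permSnoc j σ (Fin.last n) = j := by
  simp [permSnoc]

theorem permSnoc_castSucc {n : ℕ} (j : Fin (n + 1)) (σ : Equiv.Perm (Fin n)) (k : Fin n) :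
    permSnoc j σ k.castSucc = j.succAbove (σ k) := by
  simp [permSnoc]

/-- This splits a sum over all orders by the last element, leaving a sum over all orders of the
rest. Injectivity suffices because (n + 1) · n! = (n + 1)!. -/
theorem permSnoc_bijective (n : ℕ) :
    Function.Bijective
      (fun x : Fin (n + 1) × Equiv.Perm (Fin n) => permSnoc x.1 x.2) := by
  rw [Fintype.bijective_iff_injective_and_card]
  constructor
  · rintro ⟨j, σ⟩ ⟨j', σ'⟩ h
    simp only at h
    have hj : j = j' := by
      rw [← permSnoc_last j σ, h, permSnoc_last]
    subst hj
    congr 1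
    ext k : 1
    have := permSnoc_castSucc j σ k
    rw [h, permSnoc_castSucc] at this
    exact (Fin.succAbove_right_injective this).symm
  · simp [Fintype.card_perm, Nat.factorial_succ]

theorem permPrefix_permSnoc {n : ℕ} (j : Fin (n + 1)) (σ : Equiv.Perm (Fin n)) {i : ℕ}
    (hi : i ≤ n) : permPrefix (permSnoc j σ) i = j.succAbove '' permPrefix σ i := by
  ext x
  constructor
  · rintro ⟨k, hk, rfl⟩
    obtain ⟨k, rfl⟩ : ∃ k' : Fin n, k'.castSucc = k :=
      ⟨⟨k, by omega⟩, by ext; simp⟩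
    exact ⟨σ k, ⟨k, by simpa using hk, rfl⟩, (permSnoc_castSucc j σ k).symm⟩
  · rintro ⟨_, ⟨k, hk, rfl⟩, rfl⟩
    exact ⟨k.castSucc, by simpa using hk, (permSnoc_castSucc j σ k).symm⟩

theorem permPrefix_full {n : ℕ} (π : Equiv.Perm (Fin n)) : permPrefix π n = Set.univ := by
  ext x
  simp only [Set.mem_univ, iff_true]
  exact ⟨π.symm x, (π.symm x).2, by simp⟩

-- Every prefix before the last step avoids `j`, so it is the image of a prefix of `σ`; only the
-- last step, which adds `j` to all the others, contributes a new factor.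
open Classical in
theorem changeWeight_permSnoc {n : ℕ} {β : Type*} (F : Set (Fin (n + 1)) → β) (j : Fin (n + 1))
    (σ : Equiv.Perm (Fin n)) :
    changeWeight F (permSnoc j σ) =
      changeWeight (fun A => F (j.succAbove '' A)) σ *
        if F (Set.univ \ {j}) ≠ F Set.univ then 2 else 1 := by
  rw [changeWeight, Fin.prod_univ_castSucc, changeWeight]
  congr 1
  · refine Finset.prod_congr rfl fun i _ => ?_
    rw [permPrefix_permSnoc j σ (by simp), permPrefix_permSnoc j σ (by simp)]
    simp
  · rw [permPrefix_permSnoc j σ (by simp), Fin.val_last, permPrefix_full, permPrefix_full,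
      Set.image_univ, Fin.range_succAbove, Set.compl_eq_univ_sdiff]

/-- If in every set at most four elements are critical for `F`, then the exponential moment of
the number of changes of `F` along a random permutation is polynomial. -/
theorem sum_changeWeight_le {β : Type*} : ∀ (n : ℕ) (F : Set (Fin n) → β),
    (∀ A : Set (Fin n), ∃ D : Finset (Fin n), D.card ≤ 4 ∧
      ∀ j ∈ A, j ∉ D → F (A \ {j}) = F A) →
    24 * ∑ π : Equiv.Perm (Fin n), changeWeight F π ≤ (n + 4).factorial
  | 0, F, _ => by simp [changeWeight, Nat.factorial]
  | n + 1, F, hF => by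
    classical
    rw [← (permSnoc_bijective n).sum_comp, Fintype.sum_prod_type]
    simp only [changeWeight_permSnoc, ← Finset.sum_mul]
    rw [Finset.mul_sum]
    have step : ∀ j : Fin (n + 1),
        24 * ∑ σ : Equiv.Perm (Fin n), changeWeight (fun A => F (j.succAbove '' A)) σ ≤
          (n + 4).factorial := by
      intro j
      refine sum_changeWeight_le n _ fun A => ?_
      obtain ⟨D, hD, h⟩ := hF (j.succAbove '' A)
      refine ⟨D.preimage j.succAbove Fin.succAbove_right_injective.injOn, ?_, ?_⟩
      · exact (Finset.card_le_card_of_injOn j.succAbove (by intro x; simp)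
          Fin.succAbove_right_injective.injOn).trans hD
      · intro k hk hkD
        rw [Set.image_sdiff Fin.succAbove_right_injective, Set.image_singleton]
        exact h _ (Set.mem_image_of_mem _ hk) (by simpa using hkD)
    -- Only a last value in `D` can double the weight, so the n + 1 factors sum to at most n + 5,
    -- which turns (n + 4)! into (n + 5)!.
    obtain ⟨D, hD, h⟩ := hF Set.univ
    calc _ ≤ ∑ j : Fin (n + 1), (n + 4).factorial *
          (1 + if j ∈ D then 1 else 0) := by
          refine Finset.sum_le_sum fun j _ => ?_
          rw [← mul_assoc]
          refine Nat.mul_le_mul (step j) ?_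
          by_cases hj : j ∈ D
          · simp only [hj, if_true]; split_ifs <;> omega
          · simp [h j (Set.mem_univ _) hj]
      _ = (n + 4).factorial * (n + 1 + D.card) := by
          rw [← Finset.mul_sum, Finset.sum_add_distrib]
          simp
      _ ≤ (n + 4).factorial * (n + 5) := Nat.mul_le_mul_left _ (by omega)
      _ = (n + 1 + 4).factorial := by
          rw [show n + 1 + 4 = (n + 4) + 1 by ring, Nat.factorial_succ (n + 4)]; ring

/-- The polynomial has degree four; a fifth factor n ≥ 2 absorbs the constants. This exponent is the
source of the 5 in (5 + α) / log 2. -/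
theorem factorial_add_four_le {n : ℕ} (hn : 2 ≤ n) :
    ((n + 4).factorial : ℝ) ≤ 24 * ((n : ℝ) ^ 5 * n.factorial) := by
  have h2 : (2 : ℝ) ≤ n := by exact_mod_cast hn
  have key : ((n : ℝ) + 4) * (n + 3) * (n + 2) * (n + 1) ≤ 24 * (n : ℝ) ^ 5 := by
    have h4 : ((n : ℝ) + 4) * (n + 3) ≤ (3 * n) * (3 * n) := by gcongr <;> linarith
    have h5 : ((n : ℝ) + 2) * (n + 1) ≤ (2 * n) * (2 * n) := by gcongr <;> linarith
    calc ((n : ℝ) + 4) * (n + 3) * (n + 2) * (n + 1)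
        = (((n : ℝ) + 4) * (n + 3)) * ((n + 2) * (n + 1)) := by ring
      _ ≤ ((3 * n) * (3 * n)) * ((2 * n) * (2 * n)) := by gcongr
      _ = 18 * (n : ℝ) ^ 4 * 2 := by ring
      _ ≤ 18 * (n : ℝ) ^ 4 * n := by gcongr
      _ ≤ 24 * (n : ℝ) ^ 5 := by nlinarith [pow_pos (show (0 : ℝ) < n by linarith) 5]
  have hf : ((n + 4).factorial : ℝ) =
      (((n : ℝ) + 4) * (n + 3) * (n + 2) * (n + 1)) * n.factorial := by
    simp only [Nat.factorial_succ]; push_cast; ring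
  rw [hf, ← mul_assoc]
  gcongr

/-- Markov's inequality for the exponential moment. -/
theorem card_changes_gt_le {β : Type*} {α : ℝ} {n : ℕ} (hn : 2 ≤ n)
    (F : Set (Fin n) → β)
    (hF : ∀ A : Set (Fin n), ∃ D : Finset (Fin n), D.card ≤ 4 ∧
      ∀ j ∈ A, j ∉ D → F (A \ {j}) = F A) (E : Finset (Equiv.Perm (Fin n)))
    (hE : ∀ π ∈ E, (5 + α) / Real.log 2 * Real.log n <
      ({i : Fin n | F (permPrefix π (i : ℕ)) ≠ F (permPrefix π ((i : ℕ) + 1))}.ncard : ℝ)) :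
    (E.card : ℝ) ≤ n.factorial * (n : ℝ) ^ (-α) := by
  have hn0 : (0 : ℝ) < n := by positivity
  have hlog : 0 < Real.log 2 := Real.log_pos one_lt_two
  have hpow : ∀ π ∈ E, (n : ℝ) ^ (5 + α) ≤ (changeWeight F π : ℝ) := by
    intro π hπ
    rw [changeWeight_eq_two_pow, Nat.cast_pow, Nat.cast_ofNat, ← Real.rpow_natCast,
      Real.rpow_def_of_pos hn0, Real.rpow_def_of_pos two_pos]
    refine Real.exp_le_exp.2 ?_
    have := mul_le_mul_of_nonneg_left (hE π hπ).le hlog.le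
    calc Real.log n * (5 + α) = Real.log 2 * ((5 + α) / Real.log 2 * Real.log n) := by
          field_simp
      _ ≤ _ := this
  have hsum : (E.card : ℝ) * (n : ℝ) ^ (5 + α) ≤
      ∑ π : Equiv.Perm (Fin n), (changeWeight F π : ℝ) := by
    rw [← nsmul_eq_mul]
    exact (Finset.card_nsmul_le_sum E _ _ hpow).trans
      (Finset.sum_le_sum_of_subset_of_nonneg (Finset.subset_univ _) fun _ _ _ => by positivity)
  have h24 : (24 : ℝ) * ∑ π : Equiv.Perm (Fin n), (changeWeight F π : ℝ) ≤
      (n + 4).factorial := by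
    exact_mod_cast sum_changeWeight_le n F hF
  have hfin : (E.card : ℝ) * (n : ℝ) ^ (5 + α) ≤ (n : ℝ) ^ 5 * n.factorial := by
    linarith [factorial_add_four_le hn]
  rw [Real.rpow_neg hn0.le, ← div_eq_mul_inv, le_div_iff₀ (by positivity)]
  have h5 : (n : ℝ) ^ (5 + α) = (n : ℝ) ^ 5 * (n : ℝ) ^ α := by
    rw [Real.rpow_add hn0]; norm_cast
  rw [h5] at hfin
  have : (0 : ℝ) < (n : ℝ) ^ 5 := by positivity
  nlinarith

/-! ### Plane geometry of segments in coordinates -/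

theorem mem_segment_iff_coord {x y z : ℝ × ℝ} : z ∈ segment ℝ x y ↔
    ∃ θ ∈ Set.Icc (0 : ℝ) 1, z.1 = x.1 + θ * (y.1 - x.1) ∧ z.2 = x.2 + θ * (y.2 - x.2) := by
  rw [segment_eq_image']
  simp only [Set.mem_image, Prod.ext_iff, Prod.fst_add, Prod.snd_add, Prod.smul_fst,
    Prod.smul_snd, Prod.fst_sub, Prod.snd_sub, smul_eq_mul, eq_comm]

theorem mem_openSegment_iff_coord {x y z : ℝ × ℝ} : z ∈ openSegment ℝ x y ↔
    ∃ θ ∈ Set.Ioo (0 : ℝ) 1, z.1 = x.1 + θ * (y.1 - x.1) ∧ z.2 = x.2 + θ * (y.2 - x.2) := by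
  rw [openSegment_eq_image']
  simp only [Set.mem_image, Prod.ext_iff, Prod.fst_add, Prod.snd_add, Prod.smul_fst,
    Prod.smul_snd, Prod.fst_sub, Prod.snd_sub, smul_eq_mul, eq_comm]

/-- The two orientations of a coordinate axis. -/
def axisSigns : Set ℝ := {1, -1}

theorem axisSigns_cases {σ : ℝ} (hσ : σ ∈ axisSigns) : σ = 1 ∨ σ = -1 := by
  simpa [axisSigns] using hσ

theorem neg_mem_axisSigns {σ : ℝ} (hσ : σ ∈ axisSigns) : -σ ∈ axisSigns := by
  rcases axisSigns_cases hσ with rfl | rfl <;> simp [axisSigns]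

theorem exists_axisSign_pos {x : ℝ} (hx : x ≠ 0) : ∃ σ ∈ axisSigns, 0 < σ * x := by
  rcases lt_or_gt_of_ne hx with h | h
  · exact ⟨-1, by simp [axisSigns], by linarith⟩
  · exact ⟨1, by simp [axisSigns], by linarith⟩

theorem mem_openSegment_of_vertical {p w z : ℝ × ℝ} {σ : ℝ} (hp : p.1 = w.1) (hz : z.1 = w.1)
    (h1 : σ * p.2 < σ * w.2) (h2 : σ * w.2 < σ * z.2) : w ∈ openSegment ℝ p z := by
  have hd : 0 < σ * (z.2 - p.2) := by linarith
  have hne : z.2 - p.2 ≠ 0 := right_ne_zero_of_mul hd.ne'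
  have hσ : σ ≠ 0 := left_ne_zero_of_mul hd.ne'
  have hq : (w.2 - p.2) / (z.2 - p.2) = (σ * (w.2 - p.2)) / (σ * (z.2 - p.2)) := by
    rw [mul_div_mul_left _ _ hσ]
  refine mem_openSegment_iff_coord.2 ⟨(w.2 - p.2) / (z.2 - p.2), ⟨?_, ?_⟩, ?_, ?_⟩
  · rw [hq]; exact div_pos (by linarith) hd
  · rw [hq, div_lt_one hd]; linarith
  · rw [hp, hz]; ring
  · field_simp; ring

/-- Supplies the first obstacle met on the way from `z` to `p`: by compactness some point of `K` on
the segment is nearest to `z`, and nothing in `K` lies strictly between. -/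
theorem exists_nearest_mem_segment {K : Set (ℝ × ℝ)} (hK : IsClosed K) {p z : ℝ × ℝ}
    (hp : p ∈ K) (hz : z ∉ K) :
    ∃ w ∈ K, w ∈ segment ℝ z p ∧ Disjoint (openSegment ℝ w z) K := by
  have hseg : IsCompact (segment ℝ z p) := by
    rw [segment_eq_image]
    exact isCompact_Icc.image (by fun_prop)
  obtain ⟨w, ⟨hwK, hws⟩, hmin⟩ := (hseg.inter_left hK).exists_isMinOn
    ⟨p, hp, right_mem_segment ℝ z p⟩ (f := fun w => dist w z) (by fun_prop)
  refine ⟨w, hwK, hws, Set.disjoint_left.2 fun u hu huK => ?_⟩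
  have hus : u ∈ segment ℝ z p :=
    (convex_segment z p).segment_subset hws (left_mem_segment ℝ z p)
      (openSegment_subset_segment ℝ w z hu)
  have hle : dist w z ≤ dist u z := hmin ⟨huK, hus⟩
  rw [openSegment_eq_image'] at hu
  obtain ⟨θ, ⟨h0, h1⟩, rfl⟩ := hu
  have hwz : 0 < dist w z := dist_pos.2 fun h => hz (h ▸ hwK)
  have : dist (w + θ • (z - w)) z = (1 - θ) * dist w z := by
    rw [dist_eq_norm, dist_eq_norm, show w + θ • (z - w) - z = (1 - θ) • (w - z) by module,
      norm_smul, Real.norm_of_nonneg (by linarith)]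
  simp only [this] at hle
  nlinarith

namespace PlaneSegment

theorem mem_carrier_of_mem_endpoints {s : PlaneSegment} {p : ℝ × ℝ} (hp : p ∈ s.endpoints) :
    p ∈ s.carrier := by
  rcases hp with rfl | rfl
  · exact left_mem_segment ℝ _ _
  · exact right_mem_segment ℝ _ _

theorem isClosed_carrier (s : PlaneSegment) : IsClosed s.carrier := by
  have hseg : IsCompact (segment ℝ s.a s.b) := by
    rw [segment_eq_image]
    exact isCompact_Icc.image (by fun_prop)
  exact hseg.isClosed

theorem exists_coord_of_not_endpoint {s : PlaneSegment} {w : ℝ × ℝ} (hw : w ∈ s.carrier)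
    (he : w ∉ s.endpoints) :
    ∃ θ ∈ Set.Ioo (0 : ℝ) 1, w.1 = s.a.1 + θ * (s.b.1 - s.a.1) ∧
      w.2 = s.a.2 + θ * (s.b.2 - s.a.2) := by
  have hopen : w ∈ openSegment ℝ s.a s.b :=
    mem_openSegment_of_ne_left_right (fun h => he (Or.inl h.symm)) (fun h => he (Or.inr h.symm)) hw
  exact mem_openSegment_iff_coord.1 hopen

/-- The second coordinate on the line spanned by a nonvertical segment. -/
noncomputable def height (s : PlaneSegment) (x : ℝ) : ℝ :=
  s.a.2 + (s.b.2 - s.a.2) / (s.b.1 - s.a.1) * (x - s.a.1)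

theorem height_combo (s : PlaneSegment) (x y θ : ℝ) :
    s.height (x + θ * (y - x)) = (1 - θ) * s.height x + θ * s.height y := by
  simp only [height]; ring

theorem continuous_height (s : PlaneSegment) : Continuous s.height := by
  unfold height; fun_prop

theorem mem_carrier_iff {s : PlaneSegment} (hs : s.a.1 ≠ s.b.1) {z : ℝ × ℝ} :
    z ∈ s.carrier ↔ z.1 ∈ Set.uIcc s.a.1 s.b.1 ∧ z.2 = s.height z.1 := by
  have hne : s.b.1 - s.a.1 ≠ 0 := sub_ne_zero.2 hs.symm
  rw [carrier, mem_segment_iff_coord, ← segment_eq_uIcc, segment_eq_image']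
  constructor
  · rintro ⟨θ, hθ, h1, h2⟩
    refine ⟨⟨θ, hθ, by simp [h1]⟩, ?_⟩
    rw [h2, h1, height]; field_simp; ring
  · rintro ⟨⟨θ, hθ, h1⟩, h2⟩
    simp only [smul_eq_mul] at h1
    refine ⟨θ, hθ, h1.symm, ?_⟩
    rw [h2, ← h1, height]; field_simp; ring

theorem fst_mem_uIcc {s : PlaneSegment} {z : ℝ × ℝ} (hz : z ∈ s.carrier) :
    z.1 ∈ Set.uIcc s.a.1 s.b.1 := by
  obtain ⟨θ, hθ, h1, -⟩ := mem_segment_iff_coord.1 hz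
  rw [← segment_eq_uIcc, segment_eq_image']
  exact ⟨θ, hθ, by simp [h1]⟩

theorem exists_endpoint_le {s : PlaneSegment} {x σ : ℝ} (hσ : σ ∈ axisSigns)
    (hx : x ∈ Set.uIcc s.a.1 s.b.1) : ∃ e ∈ s.endpoints, σ * e.1 ≤ σ * x := by
  rw [Set.mem_uIcc] at hx
  rcases axisSigns_cases hσ with rfl | rfl <;> rcases hx with ⟨h1, h2⟩ | ⟨h1, h2⟩
  exacts [⟨_, Or.inl rfl, by linarith⟩, ⟨_, Or.inr rfl, by linarith⟩,
    ⟨_, Or.inr rfl, by linarith⟩, ⟨_, Or.inl rfl, by linarith⟩]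

theorem exists_endpoint_gt {s : PlaneSegment} {x σ : ℝ} (hσ : σ ∈ axisSigns)
    (hx : x ∈ Set.uIoo s.a.1 s.b.1) : ∃ e ∈ s.endpoints, 0 < σ * (e.1 - x) := by
  rw [Set.uIoo, Set.mem_Ioo, inf_lt_iff, lt_sup_iff] at hx
  rcases axisSigns_cases hσ with rfl | rfl
  · rcases hx.2 with h | h
    exacts [⟨_, Or.inl rfl, by linarith⟩, ⟨_, Or.inr rfl, by linarith⟩]
  · rcases hx.1 with h | h
    exacts [⟨_, Or.inl rfl, by linarith⟩, ⟨_, Or.inr rfl, by linarith⟩]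

/-- A segment that avoids `t` stays on one side of `t` above the range of `t`. -/
theorem same_side {s t : PlaneSegment} (ht : t.a.1 ≠ t.b.1) (hd : Disjoint s.carrier t.carrier)
    {z z' : ℝ × ℝ} (hz : z ∈ s.carrier) (hz' : z' ∈ s.carrier)
    (hx : z.1 ∈ Set.uIcc t.a.1 t.b.1) (hx' : z'.1 ∈ Set.uIcc t.a.1 t.b.1) {σ : ℝ}
    (h : 0 < σ * (t.height z.1 - z.2)) : 0 < σ * (t.height z'.1 - z'.2) := by
  by_contra! hB
  set A := σ * (t.height z.1 - z.2) with hA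
  set B := σ * (t.height z'.1 - z'.2) with hB'
  have hAB : 0 < A - B := by linarith
  have hσ : σ ≠ 0 := left_ne_zero_of_mul h.ne'
  -- The gap to the line of `t` is affine along the chord from `z` to `z'`; this is its zero, where
  -- the chord would meet `t`.
  set θ := A / (A - B) with hθ
  have hθ0 : 0 ≤ θ := by positivity
  have hθ1 : θ ≤ 1 := by rw [hθ, div_le_one hAB]; linarith
  have hθe : (1 - θ) * A + θ * B = 0 := by rw [hθ]; field_simp; ring
  let w : ℝ × ℝ := (z.1 + θ * (z'.1 - z.1), z.2 + θ * (z'.2 - z.2))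
  have hws : w ∈ s.carrier := (convex_segment s.a s.b).segment_subset hz hz'
    (mem_segment_iff_coord.2 ⟨θ, ⟨hθ0, hθ1⟩, rfl, rfl⟩)
  have hwt : w ∈ t.carrier := by
    refine (mem_carrier_iff ht).2 ⟨?_, ?_⟩
    · refine (convex_uIcc (𝕜 := ℝ) t.a.1 t.b.1).segment_subset hx hx' ?_
      rw [segment_eq_image']
      exact ⟨θ, ⟨hθ0, hθ1⟩, rfl⟩
    · have : σ * (t.height w.1 - w.2) = 0 := by
        rw [← hθe, hA, hB', height_combo]; simp only [w]; ring
      have := (mul_eq_zero.1 this).resolve_left hσ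
      linarith
  exact Set.disjoint_left.1 hd hws hwt

/-- Around an interior point, a vertical segment extends both up and down, so it would block any
vertical line of sight leaving `w`. -/
theorem nonvertical_of_disjoint_openSegment {s : PlaneSegment} {w z : ℝ × ℝ}
    (hw : w ∈ s.carrier) (he : w ∉ s.endpoints) (hz : z.1 = w.1)
    (hd : Disjoint (openSegment ℝ w z) s.carrier) : s.a.1 ≠ s.b.1 := by
  intro hab
  obtain ⟨θ, hθ, h1, h2⟩ := exists_coord_of_not_endpoint hw he
  have hne : s.b.2 - s.a.2 ≠ 0 := fun h => s.ne (Prod.ext hab (sub_eq_zero.1 h).symm)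
  set k := (z.2 - w.2) / (s.b.2 - s.a.2) with hk
  have hev : ∀ᶠ ε in nhdsWithin (0 : ℝ) (Set.Ioi 0), θ + ε * k ∈ Set.Ioo (0 : ℝ) 1 := by
    have hc : Filter.Tendsto (fun ε : ℝ => θ + ε * k) (nhds 0) (nhds θ) := by
      have : Continuous fun ε : ℝ => θ + ε * k := by fun_prop
      simpa using this.tendsto 0
    exact (hc.eventually (isOpen_Ioo.mem_nhds hθ)).filter_mono nhdsWithin_le_nhds
  obtain ⟨ε, hεk, hε⟩ := (hev.and (Ioo_mem_nhdsGT (zero_lt_one' ℝ))).exists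
  let u : ℝ × ℝ := (w.1 + ε * (z.1 - w.1), w.2 + ε * (z.2 - w.2))
  have hu : u ∈ openSegment ℝ w z := mem_openSegment_iff_coord.2 ⟨ε, hε, rfl, rfl⟩
  refine Set.disjoint_left.1 hd hu
    (mem_segment_iff_coord.2 ⟨θ + ε * k, Set.Ioo_subset_Icc_self hεk, ?_, ?_⟩)
  · simp only [u, hz, h1, hab]; ring_nf
  · have : k * (s.b.2 - s.a.2) = z.2 - w.2 := by rw [hk]; field_simp
    simp only [u]
    linear_combination h2 - ε * this

end PlaneSegment

/-! ### Cells and their identification with trapezoids -/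

theorem mem_coveredBy {R : Set PlaneSegment} {z : ℝ × ℝ} :
    z ∈ coveredBy R ↔ ∃ s ∈ R, z ∈ s.carrier := by
  simp [coveredBy]

theorem mem_trapezoidalSkeleton {R : Set PlaneSegment} {z : ℝ × ℝ} :
    z ∈ trapezoidalSkeleton R ↔ z ∈ coveredBy R ∨
      ∃ s ∈ R, ∃ p ∈ s.endpoints, z ∈ verticalExtension R p := by
  simp [trapezoidalSkeleton]

theorem coveredBy_mono {R R' : Set PlaneSegment} (h : R' ⊆ R) : coveredBy R' ⊆ coveredBy R :=
  Set.biUnion_subset_biUnion_left h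

theorem isClosed_coveredBy {R : Set PlaneSegment} (hR : R.Finite) : IsClosed (coveredBy R) :=
  hR.isClosed_biUnion fun s _ => s.isClosed_carrier

/-- The open cell of points strictly inside the barriers `T` (above and below) and strictly
between the points `P` (on the left and on the right). -/
def cell (T : ℝ → Set PlaneSegment) (P : ℝ → Set (ℝ × ℝ)) : Set (ℝ × ℝ) :=
  {z | ∀ σ ∈ axisSigns, (∀ t ∈ T σ, 0 < σ * (t.height z.1 - z.2)) ∧
    ∀ p ∈ P σ, 0 < σ * (p.1 - z.1)}

/-- The closed version of `cell`. -/
def closedCell (T : ℝ → Set PlaneSegment) (P : ℝ → Set (ℝ × ℝ)) : Set (ℝ × ℝ) :=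
  {z | ∀ σ ∈ axisSigns, (∀ t ∈ T σ, 0 ≤ σ * (t.height z.1 - z.2)) ∧
    ∀ p ∈ P σ, 0 ≤ σ * (p.1 - z.1)}

theorem cell_subset_closedCell (T : ℝ → Set PlaneSegment) (P : ℝ → Set (ℝ × ℝ)) :
    cell T P ⊆ closedCell T P := fun _ hz σ hσ =>
  ⟨fun t ht => ((hz σ hσ).1 t ht).le, fun p hp => ((hz σ hσ).2 p hp).le⟩

theorem convex_cell (T : ℝ → Set PlaneSegment) (P : ℝ → Set (ℝ × ℝ)) : Convex ℝ (cell T P) := by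
  rw [convex_iff_segment_subset]
  intro x hx y hy z hz σ hσ
  obtain ⟨θ, ⟨h0, h1⟩, hz1, hz2⟩ := mem_segment_iff_coord.1 hz
  have pos : ∀ A B : ℝ, 0 < A → 0 < B → 0 < (1 - θ) * A + θ * B := by
    intro A B hA hB
    rcases h0.eq_or_lt with rfl | h0
    · simpa using hA
    · have := mul_pos h0 hB
      have := mul_nonneg (sub_nonneg.2 h1) hA.le
      linarith
  refine ⟨fun t ht => ?_, fun p hp => ?_⟩
  · have := pos _ _ ((hx σ hσ).1 t ht) ((hy σ hσ).1 t ht)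
    rw [hz1, hz2, PlaneSegment.height_combo]
    linarith
  · have := pos _ _ ((hx σ hσ).2 p hp) ((hy σ hσ).2 p hp)
    rw [hz1]
    linarith

theorem isOpen_cell {T : ℝ → Set PlaneSegment} {P : ℝ → Set (ℝ × ℝ)}
    (hT : ∀ σ ∈ axisSigns, (T σ).Finite) (hP : ∀ σ ∈ axisSigns, (P σ).Finite) :
    IsOpen (cell T P) := by
  have : cell T P = ⋂ σ ∈ axisSigns, ((⋂ t ∈ T σ, {z | 0 < σ * (t.height z.1 - z.2)}) ∩
      ⋂ p ∈ P σ, {z : ℝ × ℝ | 0 < σ * (p.1 - z.1)}) := by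
    ext z; simp [cell]
  rw [this]
  refine Set.Finite.isOpen_biInter (Set.toFinite {1, -1}) fun σ hσ => IsOpen.inter ?_ ?_
  · refine (hT σ hσ).isOpen_biInter fun t _ => isOpen_lt continuous_const ?_
    have := t.continuous_height
    fun_prop
  · exact (hP σ hσ).isOpen_biInter fun p _ => isOpen_lt continuous_const (by fun_prop)

theorem isClosed_closedCell (T : ℝ → Set PlaneSegment) (P : ℝ → Set (ℝ × ℝ)) :
    IsClosed (closedCell T P) := by
  have : closedCell T P = ⋂ σ ∈ axisSigns, ((⋂ t ∈ T σ, {z | 0 ≤ σ * (t.height z.1 - z.2)}) ∩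
      ⋂ p ∈ P σ, {z : ℝ × ℝ | 0 ≤ σ * (p.1 - z.1)}) := by
    ext z; simp [closedCell]
  rw [this]
  refine isClosed_biInter fun σ _ => IsClosed.inter ?_ ?_
  · refine isClosed_biInter fun t _ => isClosed_le continuous_const ?_
    have := t.continuous_height
    fun_prop
  · exact isClosed_biInter fun p _ => isClosed_le continuous_const (by fun_prop)

/-- The data `T`, `P` describe the trapezoid of `q` in the trapezoidal map of `R`. -/
structure IsCellOf (R : Set PlaneSegment) (q : ℝ × ℝ) (T : ℝ → Set PlaneSegment)
    (P : ℝ → Set (ℝ × ℝ)) : Prop where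
  barrier_mem : ∀ σ ∈ axisSigns, T σ ⊆ R
  barrier_subsingleton : ∀ σ ∈ axisSigns, (T σ).Subsingleton
  nonvertical : ∀ σ ∈ axisSigns, ∀ t ∈ T σ, t.a.1 ≠ t.b.1
  fst_mem : ∀ z ∈ closedCell T P, ∀ σ ∈ axisSigns, ∀ t ∈ T σ, z.1 ∈ Set.uIcc t.a.1 t.b.1
  side_subsingleton : ∀ σ ∈ axisSigns, (P σ).Subsingleton
  side_mem : ∀ σ ∈ axisSigns, ∀ p ∈ P σ, p ∈ closedCell T P
  side_endpoint : ∀ σ ∈ axisSigns, ∀ p ∈ P σ, ∃ s ∈ R, p ∈ s.endpoints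
  mem_cell : q ∈ cell T P
  cell_empty : ∀ z ∈ cell T P, z ∉ coveredBy R
  no_endpoint : ∀ s ∈ R, ∀ p ∈ s.endpoints, p ∈ closedCell T P →
    ∃ σ ∈ axisSigns, ∃ p' ∈ P σ, σ * (p'.1 - p.1) ≤ 0

namespace IsCellOf

variable {R R' : Set PlaneSegment} {q : ℝ × ℝ} {T : ℝ → Set PlaneSegment}
  {P : ℝ → Set (ℝ × ℝ)}

/-- Emptiness of the cell and absence of endpoints pass to subsets of `R`; only the segments that
define the cell have to be kept. -/
theorem mono (h : IsCellOf R q T P) (hR : R' ⊆ R) (hT : ∀ σ ∈ axisSigns, T σ ⊆ R')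
    (hP : ∀ σ ∈ axisSigns, ∀ p ∈ P σ, ∃ s ∈ R', p ∈ s.endpoints) : IsCellOf R' q T P :=
  { h with
    barrier_mem := hT
    side_endpoint := hP
    cell_empty := fun z hz hc => h.cell_empty z hz (coveredBy_mono hR hc)
    no_endpoint := fun s hs => h.no_endpoint s (hR hs) }

/-- An extension reaching `z` cannot cross a barrier, so it starts at an endpoint in the closed
cell; by `no_endpoint` that endpoint is not strictly between the side walls, while `z`, on the same
vertical line, is. -/
theorem cell_disjoint_skeleton (h : IsCellOf R q T P) {z : ℝ × ℝ} (hz : z ∈ cell T P) :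
    z ∉ trapezoidalSkeleton R := by
  intro hsk
  rcases mem_trapezoidalSkeleton.1 hsk with hc | ⟨s, hs, p, hp, hzp, hd⟩
  · exact h.cell_empty z hz hc
  have hpc : p ∈ closedCell T P := by
    intro σ hσ
    refine ⟨fun t ht => ?_, fun p' hp' => ?_⟩
    · by_contra! hneg
      have hpos := (hz σ hσ).1 t ht
      have hx := h.fst_mem z (cell_subset_closedCell _ _ hz) σ hσ t ht
      rw [← hzp] at hneg
      have hopen : (z.1, t.height z.1) ∈ openSegment ℝ p z := by
        rw [openSegment_symm]
        exact mem_openSegment_of_vertical (σ := σ) rfl hzp.symm (by linarith) (by linarith)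
      exact Set.disjoint_left.1 hd hopen (mem_coveredBy.2 ⟨t, h.barrier_mem σ hσ ht,
        (PlaneSegment.mem_carrier_iff (h.nonvertical σ hσ t ht)).2 ⟨hx, rfl⟩⟩)
    · rw [← hzp]
      exact ((hz σ hσ).2 p' hp').le
  obtain ⟨σ, hσ, p', hp', hle⟩ := h.no_endpoint s hs p hp hpc
  rw [← hzp] at hle
  exact absurd ((hz σ hσ).2 p' hp') (not_lt.2 hle)

/-- An uncovered boundary point lies on the vertical line of a side endpoint `p`. The first obstacle
`w` towards `p` must be an endpoint, whose extension then contains `z`; otherwise the segment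
through `w` would enter the cell. -/
theorem sdiff_subset_skeleton (h : IsCellOf R q T P) (hR : R.Finite)
    (hdisj : ∀ s ∈ R, ∀ t ∈ R, s ≠ t → Disjoint s.carrier t.carrier) {z : ℝ × ℝ}
    (hz : z ∈ closedCell T P) (hzo : z ∉ cell T P) : z ∈ trapezoidalSkeleton R := by
  rw [mem_trapezoidalSkeleton, or_iff_not_imp_left]
  intro hcov
  have hstrict : ∀ σ ∈ axisSigns, ∀ t ∈ T σ, 0 < σ * (t.height z.1 - z.2) := by
    intro σ hσ t ht
    refine ((hz σ hσ).1 t ht).lt_of_ne fun h0 => hcov ?_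
    refine mem_coveredBy.2 ⟨t, h.barrier_mem σ hσ ht,
      (PlaneSegment.mem_carrier_iff (h.nonvertical σ hσ t ht)).2 ⟨h.fst_mem z hz σ hσ t ht, ?_⟩⟩
    rcases axisSigns_cases hσ with rfl | rfl <;> linarith
  obtain ⟨σ, hσ, p, hp, hpz⟩ : ∃ σ ∈ axisSigns, ∃ p ∈ P σ, p.1 = z.1 := by
    by_contra! hne
    refine hzo fun σ hσ => ⟨hstrict σ hσ, fun p hp => ?_⟩
    refine ((hz σ hσ).2 p hp).lt_of_ne fun h0 => hne σ hσ p hp ?_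
    rcases axisSigns_cases hσ with rfl | rfl <;> linarith
  obtain ⟨s₀, hs₀, hps₀⟩ := h.side_endpoint σ hσ p hp
  have hps₀' := PlaneSegment.mem_carrier_of_mem_endpoints hps₀
  obtain ⟨w, hwK, hws, hwd⟩ := exists_nearest_mem_segment (isClosed_coveredBy hR)
    (mem_coveredBy.2 ⟨s₀, hs₀, hps₀'⟩) hcov
  obtain ⟨s, hs, hwc⟩ := mem_coveredBy.1 hwK
  obtain ⟨θ, ⟨hθ0, hθ1⟩, hw1, hw2⟩ := mem_segment_iff_coord.1 hws
  have hwz : w.1 = z.1 := by rw [hw1, hpz]; ring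
  by_cases he : w ∈ s.endpoints
  · exact ⟨s, hs, w, he, hwz.symm, hwd⟩
  exfalso
  have hnv : s.a.1 ≠ s.b.1 := PlaneSegment.nonvertical_of_disjoint_openSegment hwc he hwz.symm
    (hwd.mono_right fun x hx => mem_coveredBy.2 ⟨s, hs, hx⟩)
  have hwp : w ≠ p := by
    rintro rfl
    have : s = s₀ := by
      by_contra hne
      exact Set.disjoint_left.1 (hdisj s hs s₀ hs₀ hne) hwc hps₀'
    exact he (this ▸ hps₀)
  have hθ1' : θ < 1 := by
    refine hθ1.lt_of_ne ?_
    rintro rfl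
    exact hwp (Prod.ext (by linarith) (by linarith))
  have hwT : ∀ τ ∈ axisSigns, ∀ t ∈ T τ, 0 < τ * (t.height w.1 - w.2) := by
    intro τ hτ t ht
    have h1 := mul_pos (sub_pos.2 hθ1') (hstrict τ hτ t ht)
    have h2 := mul_nonneg hθ0 ((h.side_mem σ hσ p hp τ hτ).1 t ht)
    rw [hpz] at h2
    rw [hwz, hw2]
    linarith
  have hwP : ∀ p' ∈ P (-σ), 0 < -σ * (p'.1 - w.1) := by
    intro p' hp'
    have h1 := (h.mem_cell (-σ) (neg_mem_axisSigns hσ)).2 p' hp'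
    have h2 := (h.mem_cell σ hσ).2 p hp
    rw [hwz, ← hpz]
    linarith
  -- Dropping the wall through `w` makes `w` an interior point, so small moves respect all remaining
  -- constraints.
  let P' : ℝ → Set (ℝ × ℝ) := fun τ => if τ = σ then ∅ else P τ
  have hcases : ∀ τ ∈ axisSigns, τ = σ ∨ τ = -σ := by
    intro τ hτ
    rcases axisSigns_cases hσ with rfl | rfl <;> rcases axisSigns_cases hτ with rfl | rfl <;> simp
  have hopen : IsOpen (cell T P') := by
    refine isOpen_cell (fun τ hτ => (h.barrier_subsingleton τ hτ).finite) fun τ hτ => ?_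
    by_cases hτσ : τ = σ
    · simp [P', hτσ]
    · simpa [P', hτσ] using (h.side_subsingleton τ hτ).finite
  have hwmem : w ∈ cell T P' := by
    refine fun τ hτ => ⟨hwT τ hτ, fun p' hp' => ?_⟩
    by_cases hτσ : τ = σ
    · simp [P', hτσ] at hp'
    · have : τ = -σ := (hcases τ hτ).resolve_left hτσ
      simp only [P', hτσ, if_false] at hp'
      subst this
      exact hwP p' hp'
  obtain ⟨η, hη, hwa, hwb⟩ := PlaneSegment.exists_coord_of_not_endpoint hwc he
  set d := s.b.1 - s.a.1 with hd
  have hd0 : d ≠ 0 := sub_ne_zero.2 hnv.symm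
  -- Slide along `s` from `w`: the abscissa changes by -ε σ d², hence strictly to the inner side of
  -- the dropped wall, whatever the orientation of `s`.
  let γ : ℝ → ℝ × ℝ := fun ε =>
    (s.a.1 + (η - ε * (σ * d)) * (s.b.1 - s.a.1), s.a.2 + (η - ε * (σ * d)) * (s.b.2 - s.a.2))
  have hγ0 : γ 0 = w := Prod.ext (by simp [γ, hwa, hd]) (by simp [γ, hwb])
  have hγc : Filter.Tendsto γ (nhds 0) (nhds w) := by
    have : Continuous γ := by fun_prop
    simpa [hγ0] using this.tendsto 0
  have hηc : Filter.Tendsto (fun ε : ℝ => η - ε * (σ * d)) (nhds 0) (nhds η) := by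
    have : Continuous fun ε : ℝ => η - ε * (σ * d) := by fun_prop
    simpa using this.tendsto 0
  have hev := ((hγc.eventually (hopen.mem_nhds hwmem)).and
    (hηc.eventually (isOpen_Ioo.mem_nhds hη))).filter_mono
      (nhdsWithin_le_nhds (s := Set.Ioi (0 : ℝ)))
  obtain ⟨ε, ⟨hεγ, hεη⟩, hε⟩ := (hev.and self_mem_nhdsWithin).exists
  have hε : 0 < ε := hε
  refine h.cell_empty (γ ε) (fun τ hτ => ⟨(hεγ τ hτ).1, fun p' hp' => ?_⟩)
    (mem_coveredBy.2 ⟨s, hs, mem_segment_iff_coord.2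
      ⟨_, Set.Ioo_subset_Icc_self hεη, rfl, rfl⟩⟩)
  by_cases hτσ : τ = σ
  · subst hτσ
    have h1 := (hz τ hτ).2 p' hp'
    have h2 : (γ ε).1 = z.1 - ε * τ * d ^ 2 := by
      rw [← hwz, hwa]; simp only [γ, ← hd]; ring
    have h3 : 0 < ε * d ^ 2 := by positivity
    rw [h2]
    rcases axisSigns_cases hτ with rfl | rfl <;> linarith
  · exact (hεγ τ hτ).2 p' (by simpa [P', hτσ] using hp')

/-- The open cell and the exterior of the closed cell are disjoint open sets covering the complement
of the skeleton, so the component of `q` stays in the cell; convexity gives the converse. -/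
theorem connectedComponentIn_eq (h : IsCellOf R q T P) (hR : R.Finite)
    (hdisj : ∀ s ∈ R, ∀ t ∈ R, s ≠ t → Disjoint s.carrier t.carrier) :
    connectedComponentIn (trapezoidalSkeleton R)ᶜ q = cell T P := by
  refine Set.Subset.antisymm ?_ ?_
  · refine IsPreconnected.subset_left_of_subset_union (v := (closedCell T P)ᶜ)
      (isOpen_cell (fun σ hσ => (h.barrier_subsingleton σ hσ).finite)
        fun σ hσ => (h.side_subsingleton σ hσ).finite)
      (isClosed_closedCell T P).isOpen_compl ?_ ?_ ?_ isPreconnected_connectedComponentIn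
    · exact Set.disjoint_compl_right_iff_subset.2 (cell_subset_closedCell T P)
    · intro z hz
      by_contra hcon
      rw [Set.mem_union, not_or, Set.notMem_compl_iff] at hcon
      exact connectedComponentIn_subset _ _ hz (h.sdiff_subset_skeleton hR hdisj hcon.2 hcon.1)
    · exact ⟨q, mem_connectedComponentIn (h.cell_disjoint_skeleton h.mem_cell), h.mem_cell⟩
  · exact (convex_cell T P).isPreconnected.subset_connectedComponentIn h.mem_cell
      fun z hz => h.cell_disjoint_skeleton hz

end IsCellOf

/-! ### The trapezoid of a point, on and off the skeleton -/

theorem trapezoidContaining_of_mem {R : Set PlaneSegment} {q : ℝ × ℝ}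
    (hq : q ∈ trapezoidalSkeleton R) : trapezoidContaining R q = ∅ := by
  refine Set.eq_empty_of_forall_notMem ?_
  rintro _ ⟨⟨z, -, rfl⟩, hqz⟩
  exact connectedComponentIn_subset _ _ hqz hq

theorem trapezoidContaining_of_notMem {R : Set PlaneSegment} {q : ℝ × ℝ}
    (hq : q ∉ trapezoidalSkeleton R) :
    trapezoidContaining R q = {connectedComponentIn (trapezoidalSkeleton R)ᶜ q} := by
  ext Δ
  constructor
  · rintro ⟨⟨z, -, rfl⟩, hqz⟩
    exact connectedComponentIn_eq hqz
  · rintro rfl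
    exact ⟨⟨q, hq, rfl⟩, mem_connectedComponentIn hq⟩

theorem IsCellOf.trapezoidContaining_eq {R : Set PlaneSegment} {q : ℝ × ℝ}
    {T : ℝ → Set PlaneSegment} {P : ℝ → Set (ℝ × ℝ)} (h : IsCellOf R q T P) (hR : R.Finite)
    (hdisj : ∀ s ∈ R, ∀ t ∈ R, s ≠ t → Disjoint s.carrier t.carrier) :
    trapezoidContaining R q = {cell T P} := by
  rw [trapezoidContaining_of_notMem (h.cell_disjoint_skeleton h.mem_cell),
    h.connectedComponentIn_eq hR hdisj]

/-! ### Construction of the cell of a point and its critical segments -/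

section Existence

variable {R : Set PlaneSegment} {q : ℝ × ℝ}

/-- The first segment hit by a vertical ray from a point off the skeleton. -/
theorem exists_barrier (hR : R.Finite) (hq : q ∉ trapezoidalSkeleton R) (σ : ℝ) :
    ∃ T ⊆ R, T.Subsingleton ∧
      (∀ t ∈ T, q.1 ∈ Set.uIoo t.a.1 t.b.1 ∧ 0 < σ * (t.height q.1 - q.2)) ∧
      ∀ z ∈ coveredBy R, z.1 = q.1 → 0 < σ * (z.2 - q.2) →
        ∃ t ∈ T, σ * (t.height q.1 - z.2) ≤ 0 := by
  by_cases hne : ∃ z ∈ coveredBy R, z.1 = q.1 ∧ 0 < σ * (z.2 - q.2)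
  swap
  · push Not at hne
    refine ⟨∅, Set.empty_subset _, Set.subsingleton_empty, by simp, fun z hz h1 h2 => ?_⟩
    exact absurd h2 (not_lt.2 (hne z hz h1))
  obtain ⟨p, hp, hpq, hpσ⟩ := hne
  have hqc : q ∉ coveredBy R := fun h => hq (mem_trapezoidalSkeleton.2 (Or.inl h))
  obtain ⟨w, hwK, hws, hwd⟩ := exists_nearest_mem_segment (isClosed_coveredBy hR) hp hqc
  obtain ⟨t, ht, hwt⟩ := mem_coveredBy.1 hwK
  obtain ⟨θ, ⟨hθ0, hθ1⟩, hw1, hw2⟩ := mem_segment_iff_coord.1 hws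
  have hwq : w.1 = q.1 := by rw [hw1, hpq]; ring
  -- Otherwise `q` would lie on the vertical extension of `w`. Hence `t` is nonvertical and `q.1` is
  -- strictly inside its range.
  have he : w ∉ t.endpoints := fun he =>
    hq (mem_trapezoidalSkeleton.2 (Or.inr ⟨t, ht, w, he, hwq.symm, hwd⟩))
  have hnv : t.a.1 ≠ t.b.1 := PlaneSegment.nonvertical_of_disjoint_openSegment hwt he hwq.symm
    (hwd.mono_right fun x hx => mem_coveredBy.2 ⟨t, ht, hx⟩)
  have hh : t.height q.1 = w.2 := by
    rw [← hwq]; exact ((PlaneSegment.mem_carrier_iff hnv).1 hwt).2.symm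
  have hθ : 0 < θ := by
    refine hθ0.lt_of_ne ?_
    rintro rfl
    exact hqc ((Prod.ext (by simpa using hw1) (by simpa using hw2) : w = q) ▸ hwK)
  have hwσ : 0 < σ * (w.2 - q.2) := by
    have := mul_pos hθ hpσ
    rw [hw2]; linarith
  refine ⟨{t}, by simpa using ht, Set.subsingleton_singleton, ?_, fun z hz hzq hzσ => ?_⟩
  · rintro _ rfl
    refine ⟨?_, by rwa [hh]⟩
    obtain ⟨η, ⟨h0, h1⟩, ha, -⟩ := PlaneSegment.exists_coord_of_not_endpoint hwt he
    rw [← hwq, ha]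
    rcases lt_or_gt_of_ne hnv with hlt | hlt
    · rw [Set.uIoo_of_lt hlt]
      constructor <;> nlinarith
    · rw [Set.uIoo_of_gt hlt]
      constructor <;> nlinarith
  · refine ⟨t, rfl, ?_⟩
    rw [hh]
    by_contra! hlt
    refine Set.disjoint_left.1 hwd ?_ hz
    rw [openSegment_symm]
    exact mem_openSegment_of_vertical (σ := σ) hzq.symm (hwq.trans hzq.symm) (by linarith)
      (by linarith)

/-- The trapezoid of a point off the skeleton is described by at most two barriers and at most
two endpoints. -/
theorem exists_isCellOf (hR : R.Finite)
    (hdisj : ∀ s ∈ R, ∀ t ∈ R, s ≠ t → Disjoint s.carrier t.carrier)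
    (hq : q ∉ trapezoidalSkeleton R) : ∃ T P, IsCellOf R q T P := by
  have hex : ∀ σ : ℝ, ∃ T ⊆ R, T.Subsingleton ∧
      (∀ t ∈ T, q.1 ∈ Set.uIoo t.a.1 t.b.1 ∧ 0 < σ * (t.height q.1 - q.2)) ∧
      ∀ z ∈ coveredBy R, z.1 = q.1 → 0 < σ * (z.2 - q.2) →
        ∃ t ∈ T, σ * (t.height q.1 - z.2) ≤ 0 :=
    exists_barrier hR hq
  choose T hTR hT using hex
  have hqc : q ∉ coveredBy R := fun h => hq (mem_trapezoidalSkeleton.2 (Or.inl h))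
  have hqx : ∀ σ ∈ axisSigns, ∀ t ∈ T σ, q.1 ∈ Set.uIoo t.a.1 t.b.1 := fun σ hσ t ht =>
    ((hT σ).2.1 t ht).1
  have hqh : ∀ σ ∈ axisSigns, ∀ t ∈ T σ, 0 < σ * (t.height q.1 - q.2) := fun σ hσ t ht =>
    ((hT σ).2.1 t ht).2
  have hqX : ∀ σ ∈ axisSigns, ∀ t ∈ T σ, q.1 ∈ Set.uIcc t.a.1 t.b.1 := fun σ hσ t ht =>
    Set.Ioo_subset_Icc_self (hqx σ hσ t ht)
  have hnv : ∀ σ ∈ axisSigns, ∀ t ∈ T σ, t.a.1 ≠ t.b.1 := by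
    intro σ hσ t ht hab
    have := hqx σ hσ t ht
    rw [hab, Set.uIoo_self] at this
    exact this
  have hmemt : ∀ σ ∈ axisSigns, ∀ t ∈ T σ, ∀ x ∈ Set.uIcc t.a.1 t.b.1,
      (x, t.height x) ∈ t.carrier := fun σ hσ t ht x hx =>
    (PlaneSegment.mem_carrier_iff (hnv σ hσ t ht)).2 ⟨hx, rfl⟩
  have hray : ∀ z ∈ coveredBy R, z.1 = q.1 →
      ∃ σ ∈ axisSigns, ∃ t ∈ T σ, σ * (t.height q.1 - z.2) ≤ 0 := by
    intro z hz hzq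
    have hne : z.2 - q.2 ≠ 0 := fun h =>
      hqc ((Prod.ext hzq (sub_eq_zero.1 h) : z = q) ▸ hz)
    obtain ⟨σ, hσ, hpos⟩ := exists_axisSign_pos hne
    exact ⟨σ, hσ, (hT σ).2.2 z hz hzq hpos⟩
  have heq : ∀ s ∈ R, ∀ t ∈ R, ∀ z ∈ s.carrier, z ∈ t.carrier → s = t := by
    intro s hs t ht z hzs hzt
    by_contra hne
    exact Set.disjoint_left.1 (hdisj s hs t ht hne) hzs hzt
  have hside : ∀ τ ∈ axisSigns, ∀ t ∈ T τ, ∀ s ∈ R, s ≠ t → ∀ z ∈ s.carrier, ∀ z' ∈ s.carrier,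
      z.1 ∈ Set.uIcc t.a.1 t.b.1 → z'.1 ∈ Set.uIcc t.a.1 t.b.1 →
      0 < τ * (t.height z.1 - z.2) → 0 < τ * (t.height z'.1 - z'.2) := by
    intro τ hτ t ht s hs hst z hz z' hz' hx hx' h
    exact PlaneSegment.same_side (hnv τ hτ t ht) (hdisj s hs t (hTR τ ht) hst) hz hz' hx hx' h
  -- Candidate side endpoints: those on side `σ` of `q` not beyond a barrier. The barrier test
  -- applies only within the barrier's range; `P σ` will hold a candidate nearest to `q`
  -- horizontally.
  let E : ℝ → Set (ℝ × ℝ) := fun σ => {p | (∃ s ∈ R, p ∈ s.endpoints) ∧ 0 < σ * (p.1 - q.1) ∧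
    ∀ τ ∈ axisSigns, ∀ t ∈ T τ, p.1 ∈ Set.uIcc t.a.1 t.b.1 → 0 ≤ τ * (t.height p.1 - p.2)}
  have hEfin : ∀ σ, (E σ).Finite := by
    intro σ
    refine (hR.biUnion (t := fun s => s.endpoints) fun s _ => Set.toFinite {s.a, s.b}).subset ?_
    rintro p ⟨⟨s, hs, hp⟩, -⟩
    exact Set.mem_biUnion hs hp
  have hmin : ∀ σ, ∃ P ⊆ E σ, P.Subsingleton ∧ ∀ e ∈ E σ, ∃ p ∈ P, σ * p.1 ≤ σ * e.1 := by
    intro σ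
    rcases (E σ).eq_empty_or_nonempty with h | h
    · exact ⟨∅, Set.empty_subset _, Set.subsingleton_empty, by simp [h]⟩
    · obtain ⟨p, hp, hle⟩ := Set.exists_min_image (E σ) (fun p => σ * p.1) (hEfin σ) h
      exact ⟨{p}, by simpa using hp, Set.subsingleton_singleton, fun e he => ⟨p, rfl, hle e he⟩⟩
  choose P hPE hPs hPmin using hmin
  -- The barriers' own endpoints are candidates, since the two barriers cannot cross. So the side
  -- walls come no later than the ends of the barriers, which gives `hrange`.
  have hbarrier_end : ∀ σ ∈ axisSigns, ∀ τ ∈ axisSigns, ∀ t ∈ T τ, ∃ e ∈ t.endpoints, e ∈ E σ := by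
    intro σ hσ τ hτ t ht
    obtain ⟨e, he, hpos⟩ := PlaneSegment.exists_endpoint_gt hσ (hqx τ hτ t ht)
    refine ⟨e, he, ⟨t, hTR τ ht, he⟩, hpos, fun τ' hτ' t' ht' hx => ?_⟩
    have hec := PlaneSegment.mem_carrier_of_mem_endpoints he
    by_cases htt : t = t'
    · subst htt
      rw [((PlaneSegment.mem_carrier_iff (hnv τ hτ t ht)).1 hec).2]
      simp
    · refine (hside τ' hτ' t' ht' t (hTR τ ht) htt (q.1, t.height q.1)
        (hmemt τ hτ t ht _ (hqX τ hτ t ht)) e hec (hqX τ' hτ' t' ht') hx ?_).le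
      have h1 := hqh τ hτ t ht
      have h2 := hqh τ' hτ' t' ht'
      have hττ : τ ≠ τ' := by
        rintro rfl
        exact htt ((hT τ).1 ht ht')
      simp only
      rcases axisSigns_cases hτ with rfl | rfl <;> rcases axisSigns_cases hτ' with rfl | rfl <;>
        first
        | exact absurd rfl hττ
        | linarith
  have hrange : ∀ x : ℝ, (∀ σ ∈ axisSigns, ∀ p ∈ P σ, 0 ≤ σ * (p.1 - x)) →
      ∀ τ ∈ axisSigns, ∀ t ∈ T τ, x ∈ Set.uIcc t.a.1 t.b.1 := by
    intro x hx τ hτ t ht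
    have key : ∀ σ ∈ axisSigns, ∃ y ∈ Set.uIcc t.a.1 t.b.1, σ * x ≤ σ * y := by
      intro σ hσ
      obtain ⟨e, he, heE⟩ := hbarrier_end σ hσ τ hτ t ht
      obtain ⟨p, hp, hle⟩ := hPmin σ e heE
      refine ⟨e.1, PlaneSegment.fst_mem_uIcc (PlaneSegment.mem_carrier_of_mem_endpoints he), ?_⟩
      have := hx σ hσ p hp
      linarith
    obtain ⟨y, hy, hxy⟩ := key 1 (by simp [axisSigns])
    obtain ⟨y', hy', hxy'⟩ := key (-1) (by simp [axisSigns])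
    exact ⟨hy'.1.trans (by linarith), le_trans (by linarith) hy.2⟩
  have hqcell : q ∈ cell T P := fun σ hσ =>
    ⟨fun t ht => hqh σ hσ t ht, fun p hp => (hPE σ hp).2.1⟩
  have hstrict_ne : ∀ z ∈ cell T P, ∀ s ∈ R, z ∈ s.carrier → ∀ τ ∈ axisSigns, ∀ t ∈ T τ,
      s ≠ t := by
    rintro z hz s hs hzs τ hτ t ht rfl
    have := (hz τ hτ).1 s ht
    rw [((PlaneSegment.mem_carrier_iff (hnv τ hτ s ht)).1 hzs).2] at this
    simp at this
  have hfst : ∀ z ∈ closedCell T P, ∀ σ ∈ axisSigns, ∀ t ∈ T σ,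
      z.1 ∈ Set.uIcc t.a.1 t.b.1 := fun z hz =>
    hrange z.1 fun σ hσ => (hz σ hσ).2
  refine ⟨T, P, fun σ _ => hTR σ, fun σ hσ => (hT σ).1, hnv, hfst, fun σ _ => hPs σ, ?_,
    fun σ _ p hp => (hPE σ hp).1, hqcell, ?_, ?_⟩
  · intro σ hσ p hp
    have hpx : ∀ τ ∈ axisSigns, ∀ p' ∈ P τ, 0 ≤ τ * (p'.1 - p.1) := by
      intro τ hτ p' hp'
      by_cases h : τ = σ
      · subst h
        rw [hPs τ hp hp']; simp
      · have h1 := (hPE σ hp).2.1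
        have h2 := (hPE τ hp').2.1
        rcases axisSigns_cases hσ with rfl | rfl <;> rcases axisSigns_cases hτ with rfl | rfl <;>
          first
          | exact absurd rfl h
          | linarith
    exact fun τ hτ => ⟨fun t ht => (hPE σ hp).2.2 τ hτ t ht (hrange p.1 hpx τ hτ t ht), hpx τ hτ⟩
  · intro z hz hzc
    obtain ⟨s, hs, hzs⟩ := mem_coveredBy.1 hzc
    have hzX := hfst z (cell_subset_closedCell T P hz)
    have hmove : ∀ z' ∈ s.carrier, ∀ τ ∈ axisSigns, ∀ t ∈ T τ, z'.1 ∈ Set.uIcc t.a.1 t.b.1 →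
        0 < τ * (t.height z'.1 - z'.2) := fun z' hz' τ hτ t ht hx =>
      hside τ hτ t ht s hs (hstrict_ne z hz s hs hzs τ hτ t ht) z hzs z' hz' (hzX τ hτ t ht) hx
        ((hz τ hτ).1 t ht)
    -- A segment entering the cell stays strictly between the barriers over their ranges; on the
    -- vertical line of `q` it would block the ray before the barrier. So it has an endpoint between
    -- `q` and `z` horizontally, nearer than the chosen wall.
    have hnotq : ∀ w ∈ s.carrier, w.1 ≠ q.1 := by
      intro w hw hwq
      obtain ⟨τ, hτ, t, ht, hle⟩ := hray w (mem_coveredBy.2 ⟨s, hs, hw⟩) hwq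
      have := hmove w hw τ hτ t ht (hwq ▸ hqX τ hτ t ht)
      rw [hwq] at this
      linarith
    obtain ⟨σ, hσ, hpos⟩ := exists_axisSign_pos (sub_ne_zero.2 (hnotq z hzs))
    obtain ⟨e, he, hle⟩ := PlaneSegment.exists_endpoint_le hσ (PlaneSegment.fst_mem_uIcc hzs)
    have hec := PlaneSegment.mem_carrier_of_mem_endpoints he
    by_cases hepos : 0 < σ * (e.1 - q.1)
    · obtain ⟨p, hp, hpe⟩ := hPmin σ e
        ⟨⟨s, hs, he⟩, hepos, fun τ hτ t ht hx => (hmove e hec τ hτ t ht hx).le⟩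
      have := (hz σ hσ).2 p hp
      linarith
    · have hq1 : q.1 ∈ segment ℝ e.1 z.1 := by
        rw [segment_eq_uIcc, Set.mem_uIcc]
        rcases axisSigns_cases hσ with rfl | rfl
        · left; constructor <;> linarith
        · right; constructor <;> linarith
      rw [segment_eq_image'] at hq1
      obtain ⟨θ, hθ, hθq⟩ := hq1
      exact hnotq (e.1 + θ * (z.1 - e.1), e.2 + θ * (z.2 - e.2))
        ((convex_segment s.a s.b).segment_subset hec hzs
          (mem_segment_iff_coord.2 ⟨θ, hθ, rfl, rfl⟩)) hθq
  · intro s hs p hp hpc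
    have hpcar := PlaneSegment.mem_carrier_of_mem_endpoints hp
    -- An endpoint of the closed cell on the vertical line of `q` would have to lie on a barrier,
    -- hence be an end of that barrier, but `q.1` is strictly inside its range.
    have hpq : p.1 - q.1 ≠ 0 := by
      intro h0
      have hpq : p.1 = q.1 := sub_eq_zero.1 h0
      obtain ⟨τ, hτ, t, ht, hle⟩ := hray p (mem_coveredBy.2 ⟨s, hs, hpcar⟩) hpq
      have hge := (hpc τ hτ).1 t ht
      rw [hpq] at hge
      have hpt : p ∈ t.carrier := by
        refine (PlaneSegment.mem_carrier_iff (hnv τ hτ t ht)).2 ⟨hpq ▸ hqX τ hτ t ht, ?_⟩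
        rw [hpq]
        rcases axisSigns_cases hτ with rfl | rfl <;> linarith
      obtain rfl := heq s hs t (hTR τ ht) p hpcar hpt
      have hin := hqx τ hτ s ht
      rw [← hpq, Set.uIoo, Set.mem_Ioo, inf_lt_iff, lt_sup_iff] at hin
      rcases hp with rfl | rfl
      · exact lt_asymm (hin.1.resolve_left (lt_irrefl _)) (hin.2.resolve_left (lt_irrefl _))
      · exact lt_asymm (hin.1.resolve_right (lt_irrefl _)) (hin.2.resolve_right (lt_irrefl _))
    obtain ⟨σ, hσ, hpos⟩ := exists_axisSign_pos hpq
    obtain ⟨p', hp', hle⟩ := hPmin σ p ⟨⟨s, hs, hp⟩, hpos, fun τ hτ t ht _ => (hpc τ hτ).1 t ht⟩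
    exact ⟨σ, hσ, p', hp', by linarith⟩

/-- The trapezoid of `q` is determined by at most four of the segments. -/
theorem exists_critical_segments (hR : R.Finite)
    (hdisj : ∀ s ∈ R, ∀ t ∈ R, s ≠ t → Disjoint s.carrier t.carrier) (q : ℝ × ℝ) :
    ∃ D ⊆ R, D.encard ≤ 4 ∧ ∀ R' ⊆ R, D ⊆ R' →
      trapezoidContaining R' q = trapezoidContaining R q := by
  by_cases hq : q ∈ trapezoidalSkeleton R
  -- On the skeleton one segment suffices: it covers `q`, or it owns an endpoint whose extension
  -- reaches `q`, and removing other segments only lengthens extensions.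
  · obtain ⟨s, hsR, hs⟩ : ∃ s ∈ R, ∀ R' ⊆ R, s ∈ R' → q ∈ trapezoidalSkeleton R' := by
      rcases mem_trapezoidalSkeleton.1 hq with hc | ⟨s, hs, p, hp, hqp, hd⟩
      · obtain ⟨s, hs, hqs⟩ := mem_coveredBy.1 hc
        exact ⟨s, hs, fun R' _ hs =>
          mem_trapezoidalSkeleton.2 (Or.inl (mem_coveredBy.2 ⟨s, hs, hqs⟩))⟩
      · exact ⟨s, hs, fun R' hR' hs => mem_trapezoidalSkeleton.2
          (Or.inr ⟨s, hs, p, hp, hqp, hd.mono_right (coveredBy_mono hR')⟩)⟩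
    refine ⟨{s}, by simpa using hsR, by rw [Set.encard_singleton]; norm_num, fun R' hR' hD => ?_⟩
    rw [trapezoidContaining_of_mem hq, trapezoidContaining_of_mem (hs R' hR' (hD rfl))]
  · obtain ⟨T, P, h⟩ := exists_isCellOf hR hdisj hq
    have hW : ∀ σ ∈ axisSigns, ∃ W ⊆ R, W.Subsingleton ∧
        ∀ p ∈ P σ, ∃ s ∈ W, p ∈ s.endpoints := by
      intro σ hσ
      rcases (h.side_subsingleton σ hσ).eq_empty_or_singleton with hP | ⟨p, hP⟩
      · exact ⟨∅, Set.empty_subset _, Set.subsingleton_empty, by simp [hP]⟩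
      · obtain ⟨s, hs, hp⟩ := h.side_endpoint σ hσ p (by simp [hP])
        exact ⟨{s}, by simpa using hs, Set.subsingleton_singleton, by simpa [hP] using hp⟩
    have h1 : (1 : ℝ) ∈ axisSigns := by simp [axisSigns]
    have h2 : (-1 : ℝ) ∈ axisSigns := by simp [axisSigns]
    obtain ⟨W₁, hWR₁, hW₁, hP₁⟩ := hW 1 h1
    obtain ⟨W₂, hWR₂, hW₂, hP₂⟩ := hW (-1) h2
    refine ⟨(T 1 ∪ T (-1)) ∪ (W₁ ∪ W₂), Set.union_subset
      (Set.union_subset (h.barrier_mem 1 h1) (h.barrier_mem (-1) h2))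
      (Set.union_subset hWR₁ hWR₂), ?_, fun R' hR' hD => ?_⟩
    · have hT₁ := Set.encard_le_one_iff_subsingleton.2 (h.barrier_subsingleton 1 h1)
      have hT₂ := Set.encard_le_one_iff_subsingleton.2 (h.barrier_subsingleton (-1) h2)
      have hW₁' := Set.encard_le_one_iff_subsingleton.2 hW₁
      have hW₂' := Set.encard_le_one_iff_subsingleton.2 hW₂
      calc _ ≤ (T 1 ∪ T (-1)).encard + (W₁ ∪ W₂).encard := Set.encard_union_le _ _
        _ ≤ ((T 1).encard + (T (-1)).encard) + (W₁.encard + W₂.encard) :=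
          add_le_add (Set.encard_union_le _ _) (Set.encard_union_le _ _)
        _ ≤ (1 + 1) + (1 + 1) := by gcongr
        _ = 4 := by norm_num
    · rw [Set.union_subset_iff, Set.union_subset_iff, Set.union_subset_iff] at hD
      have h' : IsCellOf R' q T P := by
        refine h.mono hR' (fun σ hσ => ?_) fun σ hσ p hp => ?_
        · rcases axisSigns_cases hσ with rfl | rfl
          exacts [hD.1.1, hD.1.2]
        · rcases axisSigns_cases hσ with rfl | rfl
          · obtain ⟨s, hs, hps⟩ := hP₁ p hp
            exact ⟨s, hD.2.1 hs, hps⟩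
          · obtain ⟨s, hs, hps⟩ := hP₂ p hp
            exact ⟨s, hD.2.2 hs, hps⟩
      rw [h.trapezoidContaining_eq hR hdisj, h'.trapezoidContaining_eq (hR.subset hR')
        fun s hs t ht => hdisj s (hR' hs) t (hR' ht)]

end Existence

/-! ### From segments to indices, and the tail bound -/

theorem exists_critical_indices {n : ℕ} (S : Fin n → PlaneSegment)
    (hS : ∀ i j : Fin n, i ≠ j → Disjoint (S i).carrier (S j).carrier) (q : ℝ × ℝ)
    (A : Set (Fin n)) : ∃ D : Finset (Fin n), D.card ≤ 4 ∧ ∀ j ∈ A, j ∉ D →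
      trapezoidContaining (S '' (A \ {j})) q = trapezoidContaining (S '' A) q := by
  classical
  have hinj : Function.Injective S := by
    intro i j hij
    by_contra hne
    have := hS i j hne
    rw [hij] at this
    exact Set.disjoint_left.1 this (left_mem_segment ℝ _ _) (left_mem_segment ℝ _ _)
  obtain ⟨D, hDR, hD, hcrit⟩ := exists_critical_segments (R := S '' A) (Set.toFinite _)
    (by
      rintro _ ⟨i, -, rfl⟩ _ ⟨j, -, rfl⟩ hij
      exact hS i j fun h => hij (h ▸ rfl)) q
  refine ⟨Finset.univ.filter fun j => S j ∈ D, ?_, fun j hj hjD => ?_⟩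
  · have himg : S '' ((Finset.univ.filter fun j => S j ∈ D : Finset (Fin n)) : Set (Fin n)) ⊆ D := by
      rintro _ ⟨j, hj, rfl⟩
      simpa using hj
    have := (Set.encard_le_encard himg).trans hD
    rw [hinj.encard_image, Set.encard_coe_eq_coe_finsetCard] at this
    exact_mod_cast this
  · refine hcrit _ (Set.image_mono Set.sdiff_subset) fun s hs => ?_
    obtain ⟨i, hi, rfl⟩ := hDR hs
    refine ⟨i, ⟨hi, ?_⟩, rfl⟩
    rintro rfl
    exact hjD (by simpa using hs)

theorem mainTheorem6 (α : ℝ) (hα : 0 < α) :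
    ∃ C : ℝ, 0 < C ∧ ∀ (n : ℕ) (S : Fin n → PlaneSegment),
      (∀ i j : Fin n, i ≠ j → Disjoint (S i).carrier (S j).carrier) →
      ∀ q : ℝ × ℝ,
        (PMF.uniformOfFintype (Equiv.Perm (Fin n))).toOuterMeasure
            {π | C * Real.log (n : ℝ) < (ricChanges S π q : ℝ)}
          ≤ ENNReal.ofReal ((n : ℝ) ^ (-α)) := by
  classical
  have hlog : 0 < Real.log 2 := Real.log_pos one_lt_two
  refine ⟨(5 + α) / Real.log 2, by positivity, fun n S hS q => ?_⟩
  rw [PMF.toOuterMeasure_uniformOfFintype_apply]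
  rcases Nat.lt_or_ge n 2 with hn | hn
  -- For n = 0 there are no steps and `Real.log 0 = 0`, so the event is empty; for n = 1 the bound
  -- is 1.
  · interval_cases n
    · simp [ricChanges, Set.eq_empty_of_isEmpty]
    · simp only [Nat.cast_one, Real.one_rpow, ENNReal.ofReal_one]
      refine ENNReal.div_le_of_le_mul ?_
      rw [one_mul]
      exact_mod_cast Fintype.card_subtype_le _
  have hpre : ∀ (π : Equiv.Perm (Fin n)) (i : ℕ), ricPrefix S π i = S '' permPrefix π i := by
    intro π i
    ext s
    constructor
    · rintro ⟨j, hj, rfl⟩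
      exact ⟨π j, ⟨j, hj, rfl⟩, rfl⟩
    · rintro ⟨_, ⟨j, hj, rfl⟩, rfl⟩
      exact ⟨j, hj, rfl⟩
  have key := card_changes_gt_le (α := α) hn (fun A => trapezoidContaining (S '' A) q) (exists_critical_indices S hS q)
    (Finset.univ.filter fun π => (5 + α) / Real.log 2 * Real.log n < (ricChanges S π q : ℝ))
    (by
      intro π hπ
      simpa [ricChanges, hpre] using hπ)
  refine ENNReal.div_le_of_le_mul ?_
  rw [Fintype.card_perm, Fintype.card_fin]
  have h1 := ENNReal.ofReal_le_ofReal key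
  rw [ENNReal.ofReal_mul (by positivity), ENNReal.ofReal_natCast, ENNReal.ofReal_natCast,
    ← Fintype.card_subtype] at h1
  exact h1.trans_eq (mul_comm _ _)
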